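/- Let $G$ be a finite simple graph on $n$ vertices without isolated vertices. Suppose that $G$ is symmetric (arc-transitive), that is, for all vertices $w,x,y,z$ with $w\sim x$ and $y\sim z$ there is an automorphism of $G$ mapping $w$ to $y$ and $x$ to $z$. Suppose further that $G$ is not bipartite, and that $G$ is isomorphic neither to the complete graph $K_n$ nor (for even $n$) to $2K_{n/2}$, the disjoint union of two complete graphs on $n/2$ vertices. Then $G$ is representable in $\mathbb{R}^{n-3}$: there are an injective map $f\colon V(G)\to\mathbb{R}^{n-3}$ and distinct positive constants $\alpha\neq\beta$ such that for all distinct vertices $u,v$ the Euclidean distance $\|f(u)-f(v)\|$ equals $\alpha$ if $u\sim v$, and $\beta$ otherwise. -/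

import Mathlib

/-- `G` is representable in `ℝ^m`: the vertices can be placed in Euclidean `m`-space so that, for
two distinct positive constants `α`, `β`, distinct vertices are at distance `α` if adjacent and `β`
otherwise. (As `α` and `β` are positive, the placement is automatically injective.) -/
def Representable {V : Type*} (G : SimpleGraph V) (m : ℕ) : Prop :=
  ∃ (f : V → EuclideanSpace ℝ (Fin m)) (α β : ℝ), 0 < α ∧ 0 < β ∧ α ≠ β ∧
    (∀ u v, G.Adj u v → ‖f u - f v‖ = α) ∧
    (∀ u v, u ≠ v → ¬ G.Adj u v → ‖f u - f v‖ = β)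

/-- `G` is symmetric (arc-transitive): any ordered pair of adjacent vertices can be mapped to any
other one by an automorphism of `G`. -/
def SymmetricGraph {V : Type*} (G : SimpleGraph V) : Prop :=
  ∀ w x y z : V, G.Adj w x → G.Adj y z → ∃ φ : G ≃g G, φ w = y ∧ φ x = z

/-- The graph `2K_m`, the disjoint union of two complete graphs on `m` vertices. -/
def twoComplete (m : ℕ) : SimpleGraph (Fin m ⊕ Fin m) :=
  SimpleGraph.completeGraph (Fin m) ⊕g SimpleGraph.completeGraph (Fin m)

/-! A positive semidefinite matrix with constant diagonal `d`, one entry on edges and another on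
non-edges, both below `d`, is the Gram matrix of a representation; nullity at least 3 puts it in
dimension `n - 3`. Let `A` be the adjacency matrix, `r` the degree and `l` the least eigenvalue.
Arc-transitivity and non-bipartiteness make `l` at least a double eigenvalue
(`SymmetricGraph.exists_linearIndependent`). An edge forces `l ≤ -1`. If `l < -1`, subtracting from
`A - l I` the multiple of the all-ones matrix that kills the vector `1` gives a third null vector.
If `l = -1`, the graph is a disjoint union of cliques, at least three since `K_n` and `2K_{n/2}` are
excluded, and the Laplacian serves. -/

theorem exists_linearIsometry_of_finrank_le {E F : Type*} [NormedAddCommGroup E] [InnerProductSpace ℝ E]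
    [FiniteDimensional ℝ E] [NormedAddCommGroup F] [InnerProductSpace ℝ F] [FiniteDimensional ℝ F]
    (h : Module.finrank ℝ E ≤ Module.finrank ℝ F) : Nonempty (E →ₗᵢ[ℝ] F) := by
  let b := stdOrthonormalBasis ℝ E
  let c := stdOrthonormalBasis ℝ F
  refine ⟨(b.toBasis.constr ℝ (fun i => c (Fin.castLE h i))).isometryOfOrthonormal
    (v := b.toBasis) (by simp) ?_⟩
  have := c.orthonormal.comp (Fin.castLE h) (Fin.castLE_injective h)
  convert this using 1
  ext1 i
  simp only [Function.comp_apply, Module.Basis.constr_basis]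

/-! ### Gram matrices and least eigenvalues -/

open Matrix in
theorem exists_points_of_posSemidef {V : Type*} [Fintype V] {P : Matrix V V ℝ}
    (hP : P.PosSemidef) {k : ℕ} {w : Fin k → V → ℝ} (hw : LinearIndependent ℝ w)
    (hPw : ∀ i, P *ᵥ w i = 0) :
    ∃ f : V → EuclideanSpace ℝ (Fin (Fintype.card V - k)),
      ∀ u v, ‖f u - f v‖ ^ 2 = P u u + P v v - 2 * P u v := by
  classical
  obtain ⟨B, rfl⟩ : ∃ B : Matrix V V ℝ, P = Bᵀ * B := by
    open scoped MatrixOrder in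
    open scoped Matrix.Norms.L2Operator in
    obtain ⟨B, hB⟩ := CStarAlgebra.nonneg_iff_eq_star_mul_self.mp hP.nonneg
    exact ⟨B, by rw [hB, star_eq_conjTranspose, conjTranspose_eq_transpose_of_trivial]⟩
  let e := WithLp.linearEquiv 2 ℝ (V → ℝ)
  let L : EuclideanSpace ℝ V →ₗ[ℝ] EuclideanSpace ℝ V := e.symm.toLinearMap ∘ₗ B.mulVecLin ∘ₗ e.toLinearMap
  -- Null vectors of `P` are null for `B`, as `‖B w‖² = wᵀ P w`. So the columns of `B`, whose Gram
  -- matrix is `P`, span dimension at most `n - k`.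
  have hBw : ∀ i, e.symm (w i) ∈ LinearMap.ker L := by
    intro i
    have : B *ᵥ w i = 0 := by
      rw [← dotProduct_self_eq_zero, dotProduct_mulVec, vecMul_mulVec, ← dotProduct_mulVec, hPw i,
        dotProduct_zero]
    simp [L, this]
  have hker : k ≤ Module.finrank ℝ (LinearMap.ker L) := by
    have : LinearIndependent ℝ (fun i => (⟨e.symm (w i), hBw i⟩ : LinearMap.ker L)) :=
      LinearIndependent.of_comp (LinearMap.ker L).subtype
        (hw.map' e.symm.toLinearMap e.symm.ker)
    simpa using this.fintype_card_le_finrank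
  have hrk : Module.finrank ℝ (LinearMap.range L) ≤
      Module.finrank ℝ (EuclideanSpace ℝ (Fin (Fintype.card V - k))) := by
    have h1 := L.finrank_range_add_finrank_ker
    rw [finrank_euclideanSpace] at h1
    rw [finrank_euclideanSpace_fin]
    omega
  obtain ⟨T⟩ := exists_linearIsometry_of_finrank_le hrk
  have hL : ∀ u, L (e.symm (Pi.single u 1)) = WithLp.toLp 2 (B.col u) := by
    intro u
    simp [L, e]
  refine ⟨fun u => T ⟨WithLp.toLp 2 (B.col u), ⟨_, hL u⟩⟩, fun u v => ?_⟩
  rw [← map_sub, T.norm_map, Submodule.coe_norm, Submodule.coe_sub, EuclideanSpace.real_norm_sq_eq]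
  simp only [mul_apply, transpose_apply, Finset.mul_sum, ← Finset.sum_add_distrib,
    ← Finset.sum_sub_distrib]
  refine Finset.sum_congr rfl fun i _ => ?_
  simp only [PiLp.sub_apply, col_apply]
  ring

open Matrix in
theorem exists_least_eigenvector {V : Type*} [Fintype V] [DecidableEq V] [Nonempty V] {A : Matrix V V ℝ}
    (hA : A.IsHermitian) :
    ∃ (l : ℝ) (x : V → ℝ), x ≠ 0 ∧ A *ᵥ x = l • x ∧ (A - l • (1 : Matrix V V ℝ)).PosSemidef := by
  obtain ⟨j, hj⟩ := Finite.exists_min hA.eigenvalues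
  refine ⟨hA.eigenvalues j, hA.eigenvectorBasis j, ?_, hA.mulVec_eigenvectorBasis j, ?_⟩
  · intro h
    exact hA.eigenvectorBasis.orthonormal.ne_zero j (by ext i; exact congrFun h i)
  · rw [posSemidef_iff_isHermitian_and_spectrum_nonneg]
    refine ⟨hA.sub (by simp [IsHermitian]), ?_⟩
    rw [← Algebra.algebraMap_eq_smul_one, ← spectrum.sub_singleton_eq]
    rw [hA.spectrum_real_eq_range_eigenvalues]
    rintro _ ⟨_, ⟨i, rfl⟩, _, rfl, rfl⟩
    simpa using hj i

open Matrix in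
theorem representable_of_posSemidef {V : Type*} [Fintype V] {G : SimpleGraph V} {P : Matrix V V ℝ}
    (hP : P.PosSemidef) {k : ℕ} {w : Fin k → V → ℝ} (hw : LinearIndependent ℝ w)
    (hPw : ∀ i, P *ᵥ w i = 0) {d a b : ℝ} (hd : ∀ v, P v v = d) (ha : ∀ u v, G.Adj u v → P u v = a)
    (hb : ∀ u v, u ≠ v → ¬ G.Adj u v → P u v = b) (had : a < d) (hbd : b < d) (hab : a ≠ b) :
    Representable G (Fintype.card V - k) := by
  obtain ⟨f, hf⟩ := exists_points_of_posSemidef hP hw hPw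
  refine ⟨f, √(2 * (d - a)), √(2 * (d - b)), Real.sqrt_pos.2 (by linarith),
    Real.sqrt_pos.2 (by linarith), fun h => hab ?_, fun u v h => ?_, fun u v h h' => ?_⟩
  · rw [Real.sqrt_inj (by linarith) (by linarith)] at h
    linarith
  · rw [← Real.sqrt_sq (norm_nonneg (f u - f v)), hf, hd, hd, ha u v h]
    congr 1; ring
  · rw [← Real.sqrt_sq (norm_nonneg (f u - f v)), hf, hd, hd, hb u v h h']
    congr 1; ring

/-! ### Arc-transitivity and multiple eigenvalues -/

theorem SymmetricGraph.exists_iso {V : Type*} {G : SimpleGraph V} (h : SymmetricGraph G)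
    (hi : ∀ v, ∃ w, G.Adj v w) (u v : V) : ∃ φ : G ≃g G, φ u = v := by
  obtain ⟨u', hu⟩ := hi u
  obtain ⟨v', hv⟩ := hi v
  obtain ⟨φ, h1, -⟩ := h _ _ _ _ hu hv
  exact ⟨φ, h1⟩

theorem SymmetricGraph.exists_isRegularOfDegree {V : Type*} [Fintype V] [Nonempty V] {G : SimpleGraph V}
    [DecidableRel G.Adj] (h : SymmetricGraph G) (hi : ∀ v, ∃ w, G.Adj v w) :
    ∃ r, 0 < r ∧ G.IsRegularOfDegree r := by
  let v₀ := Classical.arbitrary V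
  refine ⟨G.degree v₀, (G.degree_pos_iff_exists_adj v₀).2 (hi v₀), fun v => ?_⟩
  obtain ⟨φ, rfl⟩ := h.exists_iso hi v₀ v
  exact φ.degree_eq v₀

open Matrix in
theorem SimpleGraph.Iso.adjMatrix_mulVec_comp {V : Type*} [Fintype V] {G : SimpleGraph V}
    [DecidableRel G.Adj] (φ : G ≃g G) (x : V → ℝ) :
    G.adjMatrix ℝ *ᵥ (x ∘ φ) = (G.adjMatrix ℝ *ᵥ x) ∘ φ := by
  ext v
  simp only [mulVec, dotProduct, Function.comp_apply]
  rw [← Equiv.sum_comp φ.toEquiv (fun u => G.adjMatrix ℝ (φ v) u * x u)]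
  refine Finset.sum_congr rfl fun u _ => ?_
  simp [SimpleGraph.adjMatrix_apply, φ.map_adj_iff]

-- If the eigenspace were a line, every automorphism would scale `x` by a sign. Then `|x|` is
-- constant on vertices and the product of the end values is constant on edges, so either `x` is
-- constant along edges, giving eigenvalue `r`, or its sign is a 2-colouring.
open Matrix in
theorem SymmetricGraph.exists_linearIndependent {V : Type*} [Fintype V] {G : SimpleGraph V}
    [DecidableRel G.Adj] (h : SymmetricGraph G) (hi : ∀ v, ∃ w, G.Adj v w) (hbip : ¬ G.IsBipartite)
    {r : ℕ} (hr : G.IsRegularOfDegree r) {l : ℝ} (hl : l ≠ r) {x : V → ℝ} (hx : x ≠ 0)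
    (hAx : G.adjMatrix ℝ *ᵥ x = l • x) :
    ∃ y, G.adjMatrix ℝ *ᵥ y = l • y ∧ LinearIndependent ℝ ![x, y] := by
  by_contra! hcon
  have hc : ∀ φ : G ≃g G, ∃ c : ℝ, c * c = 1 ∧ ∀ v, x (φ v) = c * x v := by
    intro φ
    have h1 := hcon (x ∘ φ) (by rw [φ.adjMatrix_mulVec_comp, hAx]; rfl)
    rw [LinearIndependent.pair_iff' hx] at h1
    push Not at h1
    obtain ⟨c, hc⟩ := h1
    have hc' : ∀ v, x (φ v) = c * x v := fun v => (congrFun hc v).symm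
    refine ⟨c, ?_, hc'⟩
    -- Permuting coordinates preserves the norm, so `c² = 1`.
    have h2 : ∑ v, x (φ v) * x (φ v) = ∑ v, x v * x v :=
      Equiv.sum_comp φ.toEquiv (fun v => x v * x v)
    have h3 : x ⬝ᵥ x ≠ 0 := fun h => hx (dotProduct_self_eq_zero.1 h)
    have h4 : c * c * (x ⬝ᵥ x) = 1 * (x ⬝ᵥ x) := by
      rw [dotProduct, one_mul, Finset.mul_sum, ← h2]
      refine Finset.sum_congr rfl fun v _ => ?_
      rw [hc']; ring
    exact mul_right_cancel₀ h3 h4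
  obtain ⟨v₀, hv₀⟩ : ∃ v, x v ≠ 0 := Function.ne_iff.1 hx
  obtain ⟨w₀, hw₀⟩ := hi v₀
  have hsq : ∀ v, x v * x v = x v₀ * x v₀ := by
    intro v
    obtain ⟨φ, rfl⟩ := h.exists_iso hi v₀ v
    obtain ⟨c, h1, h2⟩ := hc φ
    rw [h2]
    linear_combination x v₀ * x v₀ * h1
  have hne : ∀ v, x v ≠ 0 := fun v h0 => hv₀ (by simpa [h0] using (hsq v).symm)
  have harc : ∀ u v, G.Adj u v → x u * x v = x v₀ * x w₀ := by
    intro u v huv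
    obtain ⟨φ, rfl, rfl⟩ := h _ _ _ _ hw₀ huv
    obtain ⟨c, h1, h2⟩ := hc φ
    rw [h2, h2]
    linear_combination x v₀ * x w₀ * h1
  rcases mul_self_eq_mul_self_iff.1 (hsq w₀) with hw | hw
  · apply hl
    have h1 := congrFun hAx v₀
    rw [SimpleGraph.adjMatrix_mulVec_apply] at h1
    have h2 : ∀ u ∈ G.neighborFinset v₀, x u = x v₀ := by
      intro u hu
      have := harc v₀ u (by simpa using hu)
      rw [hw] at this
      exact mul_left_cancel₀ hv₀ this
    rw [Finset.sum_congr rfl h2, Finset.sum_const, SimpleGraph.card_neighborFinset_eq_degree, hr v₀] at h1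
    simp only [nsmul_eq_mul, Pi.smul_apply, smul_eq_mul] at h1
    exact (mul_right_cancel₀ hv₀ h1).symm
  · apply hbip
    refine (SimpleGraph.Coloring.mk (fun v => decide (0 < x v)) ?_).colorable
    intro u v huv heq
    have h1 := harc u v huv
    rw [hw, mul_neg] at h1
    have h2 : 0 < x v₀ * x v₀ := mul_self_pos.2 hv₀
    simp only [decide_eq_decide] at heq
    rcases lt_or_gt_of_ne (hne u) with hu | hu
    · have hv := (le_of_not_gt fun h0 => hu.not_gt (heq.2 h0))
      nlinarith [mul_nonneg_of_nonpos_of_nonpos hu.le hv]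
    · nlinarith [mul_pos hu (heq.1 hu)]

open Matrix in
theorem dotProduct_mulVec_three {V : Type*} [Fintype V] [DecidableEq V] (M : Matrix V V ℝ) (u v w : V)
    (a b c : ℝ) :
    (Pi.single u a + Pi.single v b + Pi.single w c) ⬝ᵥ
      (M *ᵥ (Pi.single u a + Pi.single v b + Pi.single w c)) =
    a * a * M u u + b * b * M v v + c * c * M w w + a * b * (M u v + M v u)
      + b * c * (M v w + M w v) + a * c * (M u w + M w u) := by
  simp [mulVec_add, add_dotProduct]
  ring

/-! ### Disjoint unions of cliques -/

/-- The components are cliques, and the indicators of three of them are independent null vectors of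
the Laplacian. The matrix `A + I` would not do: it collapses each clique to a point. -/
theorem representable_of_adj_trans {V : Type*} [Fintype V] [DecidableEq V] {G : SimpleGraph V}
    [DecidableRel G.Adj] {r : ℕ} (hr0 : 0 < r) (hr : G.IsRegularOfDegree r)
    (htr : ∀ u v w, G.Adj u v → G.Adj v w → u ≠ w → G.Adj u w) {w : Fin 3 → V}
    (hw : ∀ i j, i ≠ j → w i ≠ w j ∧ ¬ G.Adj (w i) (w j)) :
    Representable G (Fintype.card V - 3) := by
  have hr0' : (0 : ℝ) < r := by exact_mod_cast hr0
  let y : Fin 3 → V → ℝ := fun i v => if v = w i ∨ G.Adj (w i) v then 1 else 0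
  have hy : ∀ i j, y i (w j) = if i = j then 1 else 0 := by
    intro i j
    by_cases h : i = j
    · simp [y, h]
    · simp [y, h, (hw i j h).1.symm, (hw i j h).2]
  refine representable_of_posSemidef (G := G) (P := G.lapMatrix ℝ) (SimpleGraph.posSemidef_lapMatrix ℝ G)
    (w := y) ?_ (fun i => ?_) (d := r) (a := -1) (b := 0) (fun v => ?_) (fun u v h => ?_)
    (fun u v h h' => ?_) (by linarith) hr0' (by norm_num)
  · rw [Fintype.linearIndependent_iff]
    intro g hg i
    simpa [hy] using congrFun hg (w i)
  · rw [SimpleGraph.lapMatrix_mulVec_eq_zero_iff_forall_adj]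
    intro u v huv
    have : (u = w i ∨ G.Adj (w i) u) ↔ (v = w i ∨ G.Adj (w i) v) := by
      constructor
      · rintro (rfl | h)
        · exact .inr huv
        · by_cases h' : v = w i
          · exact .inl h'
          · exact .inr (htr _ _ _ h huv (Ne.symm h'))
      · rintro (rfl | h)
        · exact .inr huv.symm
        · by_cases h' : u = w i
          · exact .inl h'
          · exact .inr (htr _ _ _ h huv.symm (Ne.symm h'))
    simp only [y, this]
  · simp [SimpleGraph.lapMatrix, SimpleGraph.degMatrix, hr v]
  · simp [SimpleGraph.lapMatrix, SimpleGraph.degMatrix, h, h.ne]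
  · simp [SimpleGraph.lapMatrix, SimpleGraph.degMatrix, h, h']

theorem exists_iso_twoComplete {V : Type*} [Fintype V] [DecidableEq V] {G : SimpleGraph V}
    [DecidableRel G.Adj] {r : ℕ} (hr : G.IsRegularOfDegree r)
    (htr : ∀ u v w, G.Adj u v → G.Adj v w → u ≠ w → G.Adj u w) {a b : V} (hab : a ≠ b)
    (hnab : ¬ G.Adj a b) (hcov : ∀ v, v = a ∨ v = b ∨ G.Adj a v ∨ G.Adj b v) :
    Fintype.card V = 2 * (r + 1) ∧ Nonempty (G ≃g twoComplete (r + 1)) := by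
  let p : V → Prop := fun v => v = a ∨ G.Adj a v
  have hpb : ∀ v, ¬ p v ↔ (v = b ∨ G.Adj b v) := by
    intro v
    constructor
    · intro h
      rcases hcov v with h' | h' | h' | h'
      · exact absurd (.inl h') h
      · exact .inl h'
      · exact absurd (.inr h') h
      · exact .inr h'
    · rintro (rfl | h) (rfl | h')
      · exact hab rfl
      · exact hnab h'
      · exact hnab h.symm
      · exact hnab (htr _ _ _ h' h.symm hab)
  have hclique : ∀ c u v, (u = c ∨ G.Adj c u) → (v = c ∨ G.Adj c v) → u ≠ v → G.Adj u v := by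
    rintro c u v (rfl | hu) (rfl | hv) huv
    · exact absurd rfl huv
    · exact hv
    · exact hu.symm
    · exact htr _ _ _ hu.symm hv huv
  have hcard : ∀ c, Fintype.card {v // v = c ∨ G.Adj c v} = r + 1 := by
    intro c
    rw [Fintype.card_subtype, ← hr c, ← G.card_neighborFinset_eq_degree,
      ← Finset.card_insert_of_notMem (G.notMem_neighborFinset_self c)]
    congr 1
    ext v
    simp
  have ha : Fintype.card {v // p v} = r + 1 := hcard a
  have hb : Fintype.card {v // ¬ p v} = r + 1 := by
    rw [← hcard b]
    exact Fintype.card_congr (Equiv.subtypeEquivRight hpb)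
  refine ⟨?_, ⟨SimpleGraph.Iso.symm ⟨(Equiv.sumCongr (Fintype.equivFinOfCardEq ha).symm
    (Fintype.equivFinOfCardEq hb).symm).trans (Equiv.sumCompl p), ?_⟩⟩⟩
  · rw [← Fintype.card_congr (Equiv.sumCompl p), Fintype.card_sum, ha, hb, two_mul]
  · have hsep : ∀ u v, p u → ¬ p v → ¬ G.Adj u v := by
      rintro u v (rfl | hu) hv h
      · exact hv (.inr h)
      · by_cases h' : v = a
        · exact hv (.inl h')
        · exact hv (.inr (htr _ _ _ hu h (Ne.symm h')))
    rintro (i | i) (j | j)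
    · set u := (Fintype.equivFinOfCardEq ha).symm i with hu
      set v := (Fintype.equivFinOfCardEq ha).symm j with hv
      have : u = v ↔ i = j := by simp [hu, hv]
      simp only [Equiv.trans_apply, Equiv.sumCongr_apply, Sum.map_inl, Equiv.sumCompl_apply_inl,
        twoComplete, SimpleGraph.sum_adj, SimpleGraph.top_adj, ← hu, ← hv, ne_eq, ← this]
      exact ⟨fun h e => h.ne (congrArg _ e), fun h => hclique a _ _ u.2 v.2 fun e => h (Subtype.ext e)⟩
    · simpa [twoComplete] using hsep _ _ ((Fintype.equivFinOfCardEq ha).symm i).2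
        ((Fintype.equivFinOfCardEq hb).symm j).2
    · simpa [twoComplete] using fun h => hsep _ _ ((Fintype.equivFinOfCardEq ha).symm j).2
        ((Fintype.equivFinOfCardEq hb).symm i).2 (SimpleGraph.Adj.symm h)
    · set u := (Fintype.equivFinOfCardEq hb).symm i with hu
      set v := (Fintype.equivFinOfCardEq hb).symm j with hv
      have : u = v ↔ i = j := by simp [hu, hv]
      simp only [Equiv.trans_apply, Equiv.sumCongr_apply, Sum.map_inr, Equiv.sumCompl_apply_inr,
        twoComplete, SimpleGraph.sum_adj, SimpleGraph.top_adj, ← hu, ← hv, ne_eq, ← this]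
      exact ⟨fun h e => h.ne (congrArg _ e), fun h => hclique b _ _ ((hpb _).1 u.2) ((hpb _).1 v.2)
        fun e => h (Subtype.ext e)⟩

/-! ### Least eigenvalue below or equal to `-1` -/

open Matrix in
theorem representable_of_lt_neg_one {V : Type*} [Fintype V] [DecidableEq V] [Nonempty V] {G : SimpleGraph V}
    [DecidableRel G.Adj] {r : ℕ} (hr : G.IsRegularOfDegree r) {l : ℝ} (hl : l < -1)
    (hpsd : (G.adjMatrix ℝ - l • (1 : Matrix V V ℝ)).PosSemidef) {x y : V → ℝ}
    (hx : G.adjMatrix ℝ *ᵥ x = l • x) (hy : G.adjMatrix ℝ *ᵥ y = l • y)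
    (hxy : LinearIndependent ℝ ![x, y]) : Representable G (Fintype.card V - 3) := by
  have hr0 : (0 : ℝ) ≤ r := r.cast_nonneg
  have hn : (0 : ℝ) < Fintype.card V := by exact_mod_cast Fintype.card_pos
  set M := G.adjMatrix ℝ - l • (1 : Matrix V V ℝ) with hM
  set c : ℝ := (r - l) / Fintype.card V with hc
  have hcn : c * Fintype.card V = r - l := by rw [hc]; field_simp
  let J : Matrix V V ℝ := Matrix.of fun _ _ => 1
  have hJ : ∀ z, J *ᵥ z = (∑ v, z v) • (1 : V → ℝ) := by
    intro z; ext v; simp [J, mulVec, dotProduct]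
  have hA1 : G.adjMatrix ℝ *ᵥ 1 = (r : ℝ) • (1 : V → ℝ) := by
    ext v
    have := SimpleGraph.adjMatrix_mulVec_const_apply_of_regular (α := ℝ) (a := 1) hr (v := v)
    simpa [Function.const] using this
  have hM1 : M *ᵥ 1 = (r - l) • (1 : V → ℝ) := by
    rw [hM, sub_mulVec, hA1, smul_mulVec, one_mulVec, sub_smul]
  have hsymm : Mᵀ = M := by
    rw [← conjTranspose_eq_transpose_of_trivial]; exact hpsd.isHermitian
  have hM1' : ∀ z, (1 : V → ℝ) ⬝ᵥ (M *ᵥ z) = (r - l) * ∑ v, z v := by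
    intro z
    rw [dotProduct_mulVec, ← mulVec_transpose, hsymm, hM1, smul_dotProduct, one_dotProduct, smul_eq_mul]
  have hsum : ∀ z, G.adjMatrix ℝ *ᵥ z = l • z → ∑ v, z v = 0 := by
    intro z hz
    have h1 : M *ᵥ z = 0 := by rw [hM, sub_mulVec, hz, smul_mulVec, one_mulVec, sub_self]
    have h2 := hM1' z
    rw [h1, dotProduct_zero] at h2
    rcases mul_eq_zero.1 h2.symm with h | h
    · linarith
    · exact h
  have hker : ∀ z, G.adjMatrix ℝ *ᵥ z = l • z → (M - c • J) *ᵥ z = 0 := by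
    intro z hz
    rw [sub_mulVec, smul_mulVec, hJ, hsum z hz, hM, sub_mulVec, hz, smul_mulVec, one_mulVec]
    simp
  refine representable_of_posSemidef (G := G) (P := M - c • J) ?_ (w := ![1, x, y]) ?_ ?_
    (d := -l - c) (a := 1 - c) (b := -c) ?_ ?_ ?_ (by linarith) (by linarith)
    (fun h => by linarith)
  · refine .of_dotProduct_mulVec_nonneg (hpsd.isHermitian.sub ?_) fun z => ?_
    · ext i j; simp [J]
    -- With `s` the mean of `z`, the form of `M - c J` at `z` equals that of `M` at `z - s • 1`.
    · set s : ℝ := (∑ v, z v) / Fintype.card V with hs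
      have hsn : s * Fintype.card V = ∑ v, z v := by rw [hs]; field_simp
      have h1 := hpsd.dotProduct_mulVec_nonneg (z - s • 1)
      have h2 : z ⬝ᵥ (M *ᵥ 1) = (r - l) * ∑ v, z v := by
        rw [hM1, dotProduct_smul, dotProduct_one, smul_eq_mul]
      have h3 : (1 : V → ℝ) ⬝ᵥ (M *ᵥ 1) = (r - l) * Fintype.card V := by
        rw [hM1']; simp
      rw [star_trivial] at h1 ⊢
      rw [mulVec_sub, mulVec_smul, sub_dotProduct, dotProduct_sub, dotProduct_sub, smul_dotProduct,
        smul_dotProduct, dotProduct_smul, dotProduct_smul, h2, h3, hM1'] at h1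
      rw [sub_mulVec, smul_mulVec, dotProduct_sub, hJ, dotProduct_smul, dotProduct_smul, dotProduct_one]
      simp only [smul_eq_mul] at h1 ⊢
      rw [← hcn, ← hsn] at h1
      rw [← hsn]
      linarith
  · rw [LinearIndependent.pair_iff] at hxy
    rw [Fintype.linearIndependent_iff]
    intro g hg
    rw [Fin.sum_univ_three] at hg
    change g 0 • (1 : V → ℝ) + g 1 • x + g 2 • y = 0 at hg
    -- Both `x` and `y` have coordinate sum zero, so summing coordinates isolates `g 0`.
    have h0 : g 0 = 0 := by
      have h1 := congrArg (fun z : V → ℝ => ∑ v, z v) hg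
      simp only [Pi.add_apply, Pi.smul_apply, smul_eq_mul, Finset.sum_add_distrib, ← Finset.mul_sum,
        hsum x hx, hsum y hy, Pi.one_apply, Pi.zero_apply, Finset.sum_const_zero] at h1
      simpa using h1
    rw [h0, zero_smul, zero_add] at hg
    obtain ⟨h1, h2⟩ := hxy _ _ hg
    intro i
    fin_cases i <;> assumption
  · intro i
    fin_cases i
    · change (M - c • J) *ᵥ 1 = 0
      rw [sub_mulVec, hM1, smul_mulVec, hJ, ← hcn, smul_smul]
      simp
    · exact hker x hx
    · exact hker y hy
  · intro v
    simp [hM, J]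
  · intro u v h
    simp [hM, J, h, h.ne]
  · intro u v h h'
    simp [hM, J, h, h']

open Matrix in
theorem le_neg_one_of_posSemidef {V : Type*} [Fintype V] [DecidableEq V] {G : SimpleGraph V}
    [DecidableRel G.Adj] {l : ℝ} (hpsd : (G.adjMatrix ℝ - l • (1 : Matrix V V ℝ)).PosSemidef) {u v : V}
    (huv : G.Adj u v) : l ≤ -1 := by
  -- The zero third term only fits the three-vertex formula; the form equals `-2 * l - 2`.
  have h := hpsd.dotProduct_mulVec_nonneg (Pi.single u 1 + Pi.single v (-1) + Pi.single v 0)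
  rw [star_trivial, dotProduct_mulVec_three] at h
  simp [huv, huv.symm, huv.ne, huv.ne'] at h
  linarith

open Matrix in
theorem adj_trans_of_posSemidef {V : Type*} [Fintype V] [DecidableEq V] {G : SimpleGraph V}
    [DecidableRel G.Adj] (hpsd : (G.adjMatrix ℝ - (-1 : ℝ) • (1 : Matrix V V ℝ)).PosSemidef) (u v w : V)
    (huv : G.Adj u v) (hvw : G.Adj v w) (huw : u ≠ w) : G.Adj u w := by
  by_contra hn
  have hn' : ¬ G.Adj w u := fun h => hn h.symm
  -- On an induced path `u, v, w` this vector gives `A + I` the value `3 - 4 = -1`.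
  have h := hpsd.dotProduct_mulVec_nonneg (Pi.single u 1 + Pi.single v (-1) + Pi.single w 1)
  rw [star_trivial, dotProduct_mulVec_three] at h
  simp [huv, huv.symm, huv.ne, huv.ne', hvw, hvw.symm, hvw.ne, hvw.ne', huw, huw.symm, hn, hn'] at h
  linarith

theorem mainTheorem10 {V : Type*} [Fintype V] (G : SimpleGraph V) (n : ℕ)
    (hn : Fintype.card V = n)
    (hisolated : ∀ v, ∃ w, G.Adj v w)
    (hsymm : SymmetricGraph G)
    (hbip : ¬ G.IsBipartite)
    (hK : IsEmpty (G ≃g SimpleGraph.completeGraph (Fin n)))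
    (h2K : ∀ m : ℕ, n = 2 * m → IsEmpty (G ≃g twoComplete m)) :
    Representable G (n - 3) := by
  classical
  subst hn
  obtain ⟨a, b, hab, hnab⟩ : ∃ a b, a ≠ b ∧ ¬ G.Adj a b := by
    by_contra! h
    exact hK.false ⟨Fintype.equivFin V, fun {u v} => by
      simpa using ⟨fun e => h u v e, fun e => e.ne⟩⟩
  have : Nonempty V := ⟨a⟩
  obtain ⟨r, hr0, hr⟩ := hsymm.exists_isRegularOfDegree hisolated
  obtain ⟨l, x, hx, hAx, hpsd⟩ := exists_least_eigenvector (G.isHermitian_adjMatrix ℝ)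
  obtain ⟨a', haa⟩ := hisolated a
  have hl := le_neg_one_of_posSemidef hpsd haa
  have hlr : l ≠ r := by
    have : (0 : ℝ) ≤ r := r.cast_nonneg
    linarith
  rcases hl.lt_or_eq with hl | rfl
  · obtain ⟨y, hAy, hxy⟩ := hsymm.exists_linearIndependent hisolated hbip hr hlr hx hAx
    exact representable_of_lt_neg_one hr hl hpsd hAx hAy hxy
  · have htr := adj_trans_of_posSemidef hpsd
    -- Without a third clique, those of `a` and `b` cover the graph, which is then `2K_{r+1}`.
    obtain ⟨c, h1, h2, h3, h4⟩ : ∃ c, c ≠ a ∧ c ≠ b ∧ ¬ G.Adj a c ∧ ¬ G.Adj b c := by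
      by_contra! hcon
      obtain ⟨h1, ⟨φ⟩⟩ := exists_iso_twoComplete hr htr hab hnab fun v => by
        have := hcon v
        tauto
      exact (h2K _ h1).false φ
    have hs := fun u v (h : ¬ G.Adj u v) (h' : G.Adj v u) => h h'.symm
    refine representable_of_adj_trans hr0 hr htr (w := ![a, b, c]) fun i j hij => ?_
    fin_cases i <;> fin_cases j <;> first | exact absurd rfl hij | skip
    · exact ⟨hab, hnab⟩
    · exact ⟨h1.symm, h3⟩
    · exact ⟨hab.symm, hs _ _ hnab⟩
    · exact ⟨h2.symm, h4⟩
    · exact ⟨h1, hs _ _ h3⟩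
    · exact ⟨h2, hs _ _ h4⟩
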